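/- Let $k\ge 1$ and let $\alpha_1,\dots,\alpha_k,\beta_1,\dots,\beta_k$ be real numbers. Consider the planar system $$\dot x=f(y)=y\prod_{i=1}^k(y-\alpha_i)^2,\qquad \dot y=-g(x)=-x\prod_{i=1}^k(x-\beta_i)^2,$$ with first integral $H(x,y)=F(y)+G(x)$, where $F(y)=\int_0^y f(s)\,ds$ and $G(x)=\int_0^x g(s)\,ds$. Put $\alpha_0=\beta_0=0$ and assume that the $(k+1)^2$ numbers $h_{ij}=H(\beta_i,\alpha_j)$, $0\le i,j\le k$, are pairwise distinct; in increasing order they are denoted $0=h_0<h_1<\dots<h_{(k+1)^2-1}$, and $h_{(k+1)^2}=+\infty$. Then for every $h\in\bigcup_{s=0}^{(k+1)^2-1}(h_s,h_{s+1})$ (that is, for every $h>0$ different from all the $h_{ij}$) the level curve $\Gamma_h=\{(x,y)\in\mathbb R^2: H(x,y)=h\}$ is a single periodic orbit of the system, so that the period function $T(h)$, the minimal period of $\Gamma_h$, is well defined, and $$\lim_{h\to 0^+}T(h)=\frac{2\pi}{\prod_{i=1}^k|\alpha_i\beta_i|},\qquad \lim_{h\to+\infty}T(h)=0.$$ -/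

import Mathlib

open Filter Topology

namespace PeriodSystem

variable {k : ℕ}

/-- `cuspPoly a s = s ∏ᵢ (s - aᵢ)²`.  With `a = α` this is `f`, with `a = β` it is `g`. -/
def cuspPoly (a : Fin k → ℝ) (s : ℝ) : ℝ := s * ∏ i, (s - a i) ^ 2

/-- The primitive `∫₀ˢ u ∏ᵢ (u - aᵢ)² du`, i.e. `F` for `a = α` and `G` for `a = β`. -/
noncomputable def potential (a : Fin k → ℝ) (s : ℝ) : ℝ := ∫ u in (0 : ℝ)..s, cuspPoly a u

/-- The first integral `H(x, y) = F(y) + G(x)`. -/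
noncomputable def hamiltonian (α β : Fin k → ℝ) (p : ℝ × ℝ) : ℝ :=
  potential α p.2 + potential β p.1

/-- The list `0, a₁, …, a_k`, i.e. `a` preceded by the entry `a₀ = 0`. -/
def extend (a : Fin k → ℝ) : Fin (k + 1) → ℝ := Fin.cons 0 a

/-- `h_{ij} = H(β_i, α_j)` for `0 ≤ i, j ≤ k`, where `α₀ = β₀ = 0`. -/
noncomputable def criticalValue (α β : Fin k → ℝ) (ij : Fin (k + 1) × Fin (k + 1)) : ℝ :=
  hamiltonian α β (extend β ij.1, extend α ij.2)

/-- A solution, defined for all times, of `ẋ = f(y)`, `ẏ = -g(x)`. -/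
def IsSolution (α β : Fin k → ℝ) (γ : ℝ → ℝ × ℝ) : Prop :=
  ∀ t, HasDerivAt γ (cuspPoly α (γ t).2, -cuspPoly β (γ t).1) t

/-- The level curve `Γ_h = {H = h}`. -/
def levelCurve (α β : Fin k → ℝ) (h : ℝ) : Set (ℝ × ℝ) := {p | hamiltonian α β p = h}

/-- The energies `h > 0` different from all the `h_{ij}`.  When the values `h_{ij}` are arranged
as `0 = h₀ < h₁ < ⋯ < h_m`, this is the union of the intervals
`(h₀, h₁), (h₁, h₂), …, (h_m, +∞)`. -/
def regularEnergies (α β : Fin k → ℝ) : Set ℝ :=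
  {h | 0 < h ∧ ∀ ij, h ≠ criticalValue α β ij}

/-- The set `Γ` is a (nonconstant) periodic orbit of the system, and its minimal period is `T`. -/
def IsPeriodicOrbitWithMinimalPeriod (α β : Fin k → ℝ) (Γ : Set (ℝ × ℝ)) (T : ℝ) : Prop :=
  ∃ γ : ℝ → ℝ × ℝ, IsSolution α β γ ∧ Set.range γ = Γ ∧
    IsLeast {τ : ℝ | 0 < τ ∧ Function.Periodic γ τ} T

/-- The period function: `T(h)` is the minimal period of the periodic orbit `Γ_h`.
(The infimum is over a one-point set whenever `Γ_h` is a periodic orbit.) -/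
noncomputable def periodFunction (α β : Fin k → ℝ) (h : ℝ) : ℝ :=
  sInf {T : ℝ | IsPeriodicOrbitWithMinimalPeriod α β (levelCurve α β h) T}

end PeriodSystem

/-!
The orbits of `ẋ = f(y)`, `ẏ = -g(x)` are followed by an angle. In elliptic polar coordinates
`x = r sin φ / b`, `y = r cos φ / a` with constants `a, b > 0`, the angular speed is
`a b D / r²`, where `D = f(y) y + g(x) x` (`virial`), and the same quantity gives the radial
derivative `D / r` of the first integral `H`. Both summands of `D` are nonnegative, and they vanish
together only at the critical points `(β_i, α_j)`, so `D > 0` on a regular level curve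
(`virial_pos`).

Consequently `H` increases along rays, and each ray meets `Γ_h` in exactly one point; by the implicit
function theorem `Γ_h` is a curve `r = R(φ)` with `R` differentiable (`exists_radius`). Along it time
is the integral of the continuous, positive, `2π`-periodic density `R² / (a b D)`, and inverting
this integral produces a solution which runs through `Γ_h` once while the angle grows by `2π`
(`exists_isPeriodicOrbitWithMinimalPeriod`). No singular integrals occur, although `f` and `g` may
vanish on `Γ_h`. Thus `T(h)` is the integral of `R² / (a b D)` over `[0, 2π]`, and
bounds `m r² ≤ D ≤ M r²` on `Γ_h` yield `2π / (a b M) ≤ T(h) ≤ 2π / (a b m)`. That no other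
solution gives `Γ_h` a different minimal period follows from uniqueness for differential equations
(`IsPeriodicOrbitWithMinimalPeriod.unique`).

For `h → 0` the level curves shrink to the origin. With `a = ∏ |α_i|` and `b = ∏ |β_i|`, which
are nonzero because the critical values are distinct, `D / r² → 1` there, and `T(h) → 2π / (a b)`.
For `h → ∞` they recede to infinity, where `D / r² → ∞` because `k ≥ 1`, and `T(h) → 0`.
-/

open Filter Topology

namespace PeriodSystem

variable {k : ℕ}

/-! ### The potentials and the first integral -/

lemma cuspPoly_mul_self (a : Fin k → ℝ) (s : ℝ) :
    cuspPoly a s * s = s ^ 2 * ∏ i, (s - a i) ^ 2 := by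
  unfold cuspPoly; ring

lemma cuspPoly_mul_self_nonneg (a : Fin k → ℝ) (s : ℝ) : 0 ≤ cuspPoly a s * s := by
  rw [cuspPoly_mul_self]
  exact mul_nonneg (sq_nonneg _) (Finset.prod_nonneg fun i _ => sq_nonneg _)

lemma contDiff_cuspPoly (a : Fin k → ℝ) : ContDiff ℝ 1 (cuspPoly a) := by
  unfold cuspPoly
  exact contDiff_id.mul (contDiff_prod fun i _ => (contDiff_id.sub contDiff_const).pow 2)

lemma continuous_cuspPoly (a : Fin k → ℝ) : Continuous (cuspPoly a) :=
  (contDiff_cuspPoly a).continuous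

lemma exists_eq_extend_of_cuspPoly_mul_self_eq_zero {a : Fin k → ℝ} {s : ℝ}
    (h : cuspPoly a s * s = 0) : ∃ i, s = extend a i := by
  rw [cuspPoly_mul_self, mul_eq_zero, Finset.prod_eq_zero_iff] at h
  rcases h with h | ⟨i, -, h⟩
  · exact ⟨0, by simpa [extend] using h⟩
  · exact ⟨i.succ, by simpa [extend, sub_eq_zero] using h⟩

lemma hasStrictDerivAt_potential (a : Fin k → ℝ) (s : ℝ) :
    HasStrictDerivAt (potential a) (cuspPoly a s) s :=
  (continuous_cuspPoly a).integral_hasStrictDerivAt 0 s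

lemma continuous_potential (a : Fin k → ℝ) : Continuous (potential a) :=
  continuous_iff_continuousAt.2 fun s => (hasStrictDerivAt_potential a s).hasDerivAt.continuousAt

lemma hasStrictFDerivAt_hamiltonian (α β : Fin k → ℝ) (p : ℝ × ℝ) :
    HasStrictFDerivAt (hamiltonian α β)
      (cuspPoly α p.2 • ContinuousLinearMap.snd ℝ ℝ ℝ +
        cuspPoly β p.1 • ContinuousLinearMap.fst ℝ ℝ ℝ) p :=
  ((hasStrictDerivAt_potential α p.2).comp_hasStrictFDerivAt p hasStrictFDerivAt_snd).add
    ((hasStrictDerivAt_potential β p.1).comp_hasStrictFDerivAt p hasStrictFDerivAt_fst)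

lemma continuous_hamiltonian (α β : Fin k → ℝ) : Continuous (hamiltonian α β) :=
  ((continuous_potential α).comp continuous_snd).add
    ((continuous_potential β).comp continuous_fst)

lemma hamiltonian_zero (α β : Fin k → ℝ) : hamiltonian α β 0 = 0 := by
  simp [hamiltonian, potential]

/-- The chain rule for the first integral along a curve. -/
lemma hasDerivAt_hamiltonian_comp (α β : Fin k → ℝ) {x y : ℝ → ℝ} {x' y' t : ℝ}
    (hx : HasDerivAt x x' t) (hy : HasDerivAt y y' t) :
    HasDerivAt (fun s => hamiltonian α β (x s, y s))
      (cuspPoly α (y t) * y' + cuspPoly β (x t) * x') t := by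
  simpa [Function.comp_def] using
    (hasStrictFDerivAt_hamiltonian α β (x t, y t)).hasFDerivAt.comp_hasDerivAt t
      (hx.prodMk hy)

/-! ### The virial `f(y) y + g(x) x` -/

/-- The derivative `f(y) y + g(x) x` of the first integral along the dilation field
`x ∂ₓ + y ∂_y`. It also governs the angular speed of the motion. -/
noncomputable def virial (α β : Fin k → ℝ) (p : ℝ × ℝ) : ℝ :=
  cuspPoly α p.2 * p.2 + cuspPoly β p.1 * p.1

lemma continuous_virial (α β : Fin k → ℝ) : Continuous (virial α β) :=
  (((continuous_cuspPoly α).comp continuous_snd).mul continuous_snd).add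
    (((continuous_cuspPoly β).comp continuous_fst).mul continuous_fst)

lemma virial_nonneg (α β : Fin k → ℝ) (p : ℝ × ℝ) : 0 ≤ virial α β p :=
  add_nonneg (cuspPoly_mul_self_nonneg _ _) (cuspPoly_mul_self_nonneg _ _)

/-- The virial vanishes only at the critical points `(β_i, α_j)` of the first integral, which do
not lie on a regular level curve. -/
lemma virial_pos {α β : Fin k → ℝ} {h : ℝ} (hh : h ∈ regularEnergies α β) {p : ℝ × ℝ}
    (hp : hamiltonian α β p = h) : 0 < virial α β p := by
  refine lt_of_le_of_ne (virial_nonneg _ _ _) fun h0 => ?_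
  obtain ⟨h1, h2⟩ := (add_eq_zero_iff_of_nonneg (cuspPoly_mul_self_nonneg _ _)
    (cuspPoly_mul_self_nonneg _ _)).1 h0.symm
  obtain ⟨j, hj⟩ := exists_eq_extend_of_cuspPoly_mul_self_eq_zero h1
  obtain ⟨i, hi⟩ := exists_eq_extend_of_cuspPoly_mul_self_eq_zero h2
  refine hh.2 (i, j) ?_
  rw [← hp, criticalValue, ← hi, ← hj]

lemma exists_le_prod_sq_sub (hk : 1 ≤ k) (a : Fin k → ℝ) (M : ℝ) :
    ∃ S > 0, ∀ s : ℝ, S ≤ |s| → M ≤ ∏ i, (s - a i) ^ 2 := by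
  have hk' : 0 < k := hk
  obtain ⟨A, hA⟩ : ∃ A, ∀ i, |a i| ≤ A :=
    ⟨∑ i, |a i|, fun i => Finset.single_le_sum (f := fun i => |a i|)
      (fun j _ => abs_nonneg _) (Finset.mem_univ i)⟩
  have hA0 : 0 ≤ A := (abs_nonneg _).trans (hA ⟨0, hk'⟩)
  refine ⟨A + 1 + |M|, by positivity, fun s hs => ?_⟩
  have hi : ∀ i, 1 + |M| ≤ (s - a i) ^ 2 := fun i => by
    have h1 : 1 + |M| ≤ |s - a i| := by
      have := abs_sub_abs_le_abs_sub s (a i)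
      linarith [hA i]
    rw [← sq_abs]
    nlinarith [abs_nonneg M]
  calc M ≤ (1 + |M|) ^ k := by
        have := le_self_pow₀ (a := 1 + |M|) (by linarith [abs_nonneg M]) hk'.ne'
        linarith [le_abs_self M]
    _ = ∏ _i : Fin k, (1 + |M|) := by simp
    _ ≤ _ := Finset.prod_le_prod (fun _ _ => by positivity) fun i _ => hi i

/-- Far from the origin the virial dominates every multiple of the squared distance; here
`1 ≤ k` enters. -/
lemma exists_mul_le_virial (hk : 1 ≤ k) (α β : Fin k → ℝ) {M : ℝ} (hM : 0 ≤ M) :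
    ∃ S > 0, ∀ p : ℝ × ℝ, S ≤ ‖p‖ → M * (p.1 ^ 2 + p.2 ^ 2) ≤ virial α β p := by
  obtain ⟨S₁, hS₁, h₁⟩ := exists_le_prod_sq_sub hk α (2 * M)
  obtain ⟨S₂, hS₂, h₂⟩ := exists_le_prod_sq_sub hk β (2 * M)
  refine ⟨max S₁ S₂, lt_max_of_lt_left hS₁, fun p hp => ?_⟩
  have e₁ := cuspPoly_mul_self α p.2
  have e₂ := cuspPoly_mul_self β p.1
  have n₁ := cuspPoly_mul_self_nonneg α p.2
  have n₂ := cuspPoly_mul_self_nonneg β p.1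
  have hS := max_le_iff.1 hp
  unfold virial
  rw [Prod.norm_def, Real.norm_eq_abs, Real.norm_eq_abs] at hS
  rcases le_total |p.1| |p.2| with hle | hle
  · rw [max_eq_right hle] at hS
    have := mul_le_mul_of_nonneg_left (h₁ _ hS.1) (sq_nonneg p.2)
    nlinarith [sq_le_sq.2 hle]
  · rw [max_eq_left hle] at hS
    have := mul_le_mul_of_nonneg_left (h₂ _ hS.2) (sq_nonneg p.1)
    nlinarith [sq_le_sq.2 hle]

/-- The squared radius `b² x² + a² y²` of the elliptic polar coordinates
`x = r sin φ / b`, `y = r cos φ / a`. -/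
def sqRadius (a b : ℝ) (p : ℝ × ℝ) : ℝ := (b * p.1) ^ 2 + (a * p.2) ^ 2

lemma eventually_abs_cuspPoly_mul_self_sub_le (a : Fin k → ℝ) {ε : ℝ} (hε : 0 < ε) :
    ∀ᶠ s in 𝓝 (0 : ℝ), |cuspPoly a s * s - ((∏ i, |a i|) * s) ^ 2| ≤ ε * s ^ 2 := by
  have hc : Continuous fun s : ℝ => ∏ i, (s - a i) ^ 2 := by fun_prop
  have h0 : (∏ i, ((0 : ℝ) - a i) ^ 2) = (∏ i, |a i|) ^ 2 := by
    simp [Finset.prod_pow, ← Finset.abs_prod]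
  have := Metric.tendsto_nhds.1 (hc.tendsto 0) ε hε
  filter_upwards [this] with s hs
  rw [h0, Real.dist_eq] at hs
  rw [cuspPoly_mul_self, show s ^ 2 * ∏ i, (s - a i) ^ 2 - ((∏ i, |a i|) * s) ^ 2 =
    (∏ i, (s - a i) ^ 2 - (∏ i, |a i|) ^ 2) * s ^ 2 by ring, abs_mul, abs_of_nonneg (sq_nonneg s)]
  exact mul_le_mul_of_nonneg_right hs.le (sq_nonneg s)

/-- Near the origin the system is linear to leading order: with `a = ∏ |α_i|` and `b = ∏ |β_i|`
the virial is asymptotic to `b² x² + a² y²`. -/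
lemma eventually_abs_virial_sub_sqRadius_le {α β : Fin k → ℝ} (hα : ∀ i, α i ≠ 0)
    (hβ : ∀ i, β i ≠ 0) {ε : ℝ} (hε : 0 < ε) :
    ∀ᶠ p in 𝓝 (0 : ℝ × ℝ), |virial α β p - sqRadius (∏ i, |α i|) (∏ i, |β i|) p| ≤
      ε * sqRadius (∏ i, |α i|) (∏ i, |β i|) p := by
  set a := ∏ i, |α i|
  set b := ∏ i, |β i|
  have ha : 0 < a := Finset.prod_pos fun i _ => abs_pos.2 (hα i)
  have hb : 0 < b := Finset.prod_pos fun i _ => abs_pos.2 (hβ i)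
  have h1 := (continuous_snd (X := ℝ) (Y := ℝ)).tendsto 0 |>.eventually
    (eventually_abs_cuspPoly_mul_self_sub_le α (mul_pos hε (pow_pos ha 2)))
  have h2 := (continuous_fst (X := ℝ) (Y := ℝ)).tendsto 0 |>.eventually
    (eventually_abs_cuspPoly_mul_self_sub_le β (mul_pos hε (pow_pos hb 2)))
  filter_upwards [h1, h2] with p h1 h2
  unfold virial sqRadius
  rw [abs_le] at *
  constructor <;> nlinarith

/-! ### Level curves in elliptic polar coordinates -/

/-- The point with elliptic polar coordinates `r` and `φ`. The angle is measured from the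
positive `y`-axis towards the positive `x`-axis, which is the sense of rotation of the system. -/
noncomputable def polar (a b r φ : ℝ) : ℝ × ℝ := (r * (Real.sin φ / b), r * (Real.cos φ / a))

lemma sqRadius_polar {a b : ℝ} (ha : a ≠ 0) (hb : b ≠ 0) (r φ : ℝ) :
    sqRadius a b (polar a b r φ) = r ^ 2 := by
  simp only [sqRadius, polar]
  field_simp
  rw [Real.sin_sq_add_cos_sq, mul_one]

lemma exists_eq_polar {a b : ℝ} (ha : a ≠ 0) (hb : b ≠ 0) {p : ℝ × ℝ} (hp : p ≠ 0) :
    ∃ r > 0, ∃ φ, p = polar a b r φ := by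
  set z : ℂ := ⟨a * p.2, b * p.1⟩ with hz
  have hz0 : z ≠ 0 := fun h => hp <| by
    have h1 := congrArg Complex.re h
    have h2 := congrArg Complex.im h
    simp only [hz, Complex.zero_re, Complex.zero_im, mul_eq_zero, ha, hb, false_or] at h1 h2
    exact Prod.ext h2 h1
  refine ⟨‖z‖, norm_pos_iff.2 hz0, z.arg, Prod.ext ?_ ?_⟩
  · have := Complex.norm_mul_sin_arg z
    simp only [polar, ← mul_div_assoc, this]
    simp only [hz]
    field_simp
  · have := Complex.norm_mul_cos_arg z
    simp only [polar, ← mul_div_assoc, this]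
    simp only [hz]
    field_simp

lemma polar_add_two_pi (a b r φ : ℝ) : polar a b r (φ + 2 * Real.pi) = polar a b r φ := by
  simp [polar]

lemma exists_int_of_polar_eq_polar {a b r s φ ψ : ℝ} (ha : a ≠ 0) (hb : b ≠ 0) (hr : 0 < r)
    (hs : 0 < s) (h : polar a b r φ = polar a b s ψ) :
    ∃ n : ℤ, φ = ψ + n * (2 * Real.pi) := by
  have hrs : r = s := by
    have := congrArg (sqRadius a b) h
    rw [sqRadius_polar ha hb, sqRadius_polar ha hb] at this
    exact (pow_left_inj₀ hr.le hs.le two_ne_zero).1 this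
  subst hrs
  simp only [polar, Prod.mk.injEq, mul_right_inj' hr.ne', div_left_inj' ha, div_left_inj' hb] at h
  have : (φ : Real.Angle) = ψ := Real.Angle.cos_sin_inj h.2 h.1
  obtain ⟨n, hn⟩ := Real.Angle.angle_eq_iff_two_pi_dvd_sub.1 this
  exact ⟨n, by linarith⟩

lemma hasDerivAt_hamiltonian_polar (α β : Fin k → ℝ) (a b φ : ℝ) {r : ℝ} (hr : r ≠ 0) :
    HasDerivAt (fun s => hamiltonian α β (polar a b s φ)) (virial α β (polar a b r φ) / r) r := by
  have h := hasDerivAt_hamiltonian_comp α β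
    ((hasDerivAt_id r).mul_const (Real.sin φ / b)) ((hasDerivAt_id r).mul_const (Real.cos φ / a))
  refine h.congr_deriv ?_
  simp only [virial, polar, id]
  field_simp

lemma continuous_polar_radius (a b φ : ℝ) : Continuous fun r => polar a b r φ := by
  unfold polar; fun_prop

lemma monotoneOn_hamiltonian_polar (α β : Fin k → ℝ) (a b φ : ℝ) :
    MonotoneOn (fun r => hamiltonian α β (polar a b r φ)) (Set.Ici 0) := by
  refine monotoneOn_of_deriv_nonneg (convex_Ici 0)
    ((continuous_hamiltonian α β).comp (continuous_polar_radius a b φ)).continuousOn ?_ ?_ <;>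
    rw [interior_Ici] <;> intro r (hr : 0 < r)
  · exact (hasDerivAt_hamiltonian_polar α β a b φ hr.ne').differentiableAt.differentiableWithinAt
  · rw [(hasDerivAt_hamiltonian_polar α β a b φ hr.ne').deriv]
    exact div_nonneg (virial_nonneg _ _ _) hr.le

lemma sqRadius_le (a b : ℝ) (p : ℝ × ℝ) :
    sqRadius a b p ≤ (a ^ 2 + b ^ 2) * (p.1 ^ 2 + p.2 ^ 2) := by
  unfold sqRadius
  nlinarith [sq_nonneg (a * p.1), sq_nonneg (b * p.2)]

/-- The first integral is unbounded on every ray. -/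
lemma exists_le_hamiltonian_polar (hk : 1 ≤ k) (α β : Fin k → ℝ) {a b : ℝ} (ha : a ≠ 0)
    (hb : b ≠ 0) (φ h : ℝ) : ∃ r ≥ 0, h ≤ hamiltonian α β (polar a b r φ) := by
  have hab : 0 < a ^ 2 + b ^ 2 := by positivity
  obtain ⟨S, hS, hM⟩ := exists_mul_le_virial hk α β hab.le
  -- The sup norm of the point of radius `r` is at least `r / (1 + 2 (a ^ 2 + b ^ 2))`.
  have hnorm : ∀ r, S * (1 + 2 * (a ^ 2 + b ^ 2)) ≤ r → S ≤ ‖polar a b r φ‖ := by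
    intro r hr
    have hr0 : 0 < r := lt_of_lt_of_le (by positivity) hr
    have h1 := sqRadius_le a b (polar a b r φ)
    rw [sqRadius_polar ha hb] at h1
    have h2 : (polar a b r φ).1 ^ 2 ≤ ‖polar a b r φ‖ ^ 2 :=
      sq_le_sq' (abs_le.1 (norm_fst_le (polar a b r φ))).1 (abs_le.1 (norm_fst_le (polar a b r φ))).2
    have h3 : (polar a b r φ).2 ^ 2 ≤ ‖polar a b r φ‖ ^ 2 :=
      sq_le_sq' (abs_le.1 (norm_snd_le (polar a b r φ))).1 (abs_le.1 (norm_snd_le (polar a b r φ))).2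
    by_contra! hlt
    have h4 : ‖polar a b r φ‖ ^ 2 < S ^ 2 := pow_lt_pow_left₀ hlt (norm_nonneg _) two_ne_zero
    have h5 : S ^ 2 * (1 + 2 * (a ^ 2 + b ^ 2)) ^ 2 ≤ r ^ 2 := by
      rw [← mul_pow]; exact pow_le_pow_left₀ (by positivity) hr 2
    nlinarith [mul_pos (pow_pos hS 2) hab, mul_pos (pow_pos hS 2) (pow_pos hab 2)]
  set r₀ := S * (1 + 2 * (a ^ 2 + b ^ 2))
  have hr₀0 : 0 < r₀ := by positivity
  have key := (convex_Ici r₀).mul_sub_le_image_sub_of_le_deriv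
    (f := fun r => hamiltonian α β (polar a b r φ)) (C := r₀)
    ((continuous_hamiltonian α β).comp (continuous_polar_radius a b φ)).continuousOn
    (by
      rw [interior_Ici]; intro r (hr : r₀ < r)
      exact (hasDerivAt_hamiltonian_polar α β a b φ
        (hr₀0.trans hr).ne').differentiableAt.differentiableWithinAt)
    (by
      rw [interior_Ici]; intro r (hr : r₀ < r)
      have hr0 := hr₀0.trans hr
      rw [(hasDerivAt_hamiltonian_polar α β a b φ hr0.ne').deriv, le_div_iff₀ hr0]
      have h1 := sqRadius_le a b (polar a b r φ)
      rw [sqRadius_polar ha hb] at h1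
      have h2 := hM _ (hnorm r hr.le)
      nlinarith)
  have hH : 0 ≤ hamiltonian α β (polar a b r₀ φ) := by
    have := monotoneOn_hamiltonian_polar α β a b φ Set.self_mem_Ici hr₀0.le hr₀0.le
    simpa [polar, ← Prod.zero_eq_mk, hamiltonian_zero] using this
  have h0 : 0 ≤ |h| / r₀ := by positivity
  refine ⟨r₀ + |h| / r₀, by positivity, ?_⟩
  have := key r₀ Set.self_mem_Ici (r₀ + |h| / r₀) (by simpa using h0) (by simpa using h0)
  have e : r₀ * (r₀ + |h| / r₀ - r₀) = |h| := by field_simp; ring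
  simp only [e] at this
  linarith [le_abs_self h]

lemma hamiltonian_polar_inj {α β : Fin k → ℝ} {h : ℝ} (hh : h ∈ regularEnergies α β)
    {a b φ r s : ℝ} (hr : 0 < r) (hs : 0 < s) (h1 : hamiltonian α β (polar a b r φ) = h)
    (h2 : hamiltonian α β (polar a b s φ) = h) : r = s := by
  wlog hrs : r < s generalizing r s
  · rcases (not_lt.1 hrs).eq_or_lt with h' | h'
    · exact h'.symm
    · exact (this hs hr h2 h1 h').symm
  -- By monotonicity the first integral would be constant between the two points, so that the
  -- virial would vanish there.
  exfalso
  have hconst : ∀ t ∈ Set.Icc r s, hamiltonian α β (polar a b t φ) = h := fun t ht =>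
    le_antisymm
      (h2 ▸ monotoneOn_hamiltonian_polar α β a b φ (hr.le.trans ht.1) hs.le ht.2)
      (h1 ▸ monotoneOn_hamiltonian_polar α β a b φ hr.le (hr.le.trans ht.1) ht.1)
  obtain ⟨m, hm⟩ := exists_between hrs
  have hm0 : 0 < m := hr.trans hm.1
  have hd := hasDerivAt_hamiltonian_polar α β a b φ hm0.ne'
  have hd' : HasDerivAt (fun t => hamiltonian α β (polar a b t φ)) 0 m :=
    (hasDerivAt_const m h).congr_of_eventuallyEq <| by
      filter_upwards [Icc_mem_nhds hm.1 hm.2] with t ht using hconst t ht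
  exact (div_pos (virial_pos hh (hconst m ⟨hm.1.le, hm.2.le⟩)) hm0).ne' (hd.unique hd')

/-- A regular level curve is star-shaped about the origin: it is the graph `r = R(φ)` of a
differentiable function in elliptic polar coordinates. -/
lemma exists_radius (hk : 1 ≤ k) {α β : Fin k → ℝ} {h : ℝ} (hh : h ∈ regularEnergies α β)
    {a b : ℝ} (ha : a ≠ 0) (hb : b ≠ 0) :
    ∃ R : ℝ → ℝ, (∀ φ, 0 < R φ) ∧ (∀ φ, hamiltonian α β (polar a b (R φ) φ) = h) ∧
      (∀ φ r, 0 < r → hamiltonian α β (polar a b r φ) = h → r = R φ) ∧ Differentiable ℝ R := by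
  have hex : ∀ φ, ∃ r, 0 < r ∧ hamiltonian α β (polar a b r φ) = h := fun φ => by
    obtain ⟨r₁, hr₁, hle⟩ := exists_le_hamiltonian_polar hk α β ha hb φ h
    have h0 : hamiltonian α β (polar a b 0 φ) = 0 := by
      simp [polar, ← Prod.zero_eq_mk, hamiltonian_zero]
    obtain ⟨r, hr, hr'⟩ := intermediate_value_Icc hr₁
      ((continuous_hamiltonian α β).comp (continuous_polar_radius a b φ)).continuousOn
      (show h ∈ Set.Icc _ _ from ⟨by simpa [h0] using hh.1.le, hle⟩)
    refine ⟨r, lt_of_le_of_ne hr.1 fun h' => ?_, hr'⟩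
    subst h'
    exact hh.1.ne (h0.symm.trans hr')
  choose R hR hRh using hex
  have huniq : ∀ φ r, 0 < r → hamiltonian α β (polar a b r φ) = h → r = R φ := fun φ r hr h1 =>
    hamiltonian_polar_inj hh hr (hR φ) h1 (hRh φ)
  refine ⟨R, hR, hRh, huniq, fun φ => ?_⟩
  -- The implicit function theorem applies, as the radial derivative is a multiple of the virial.
  set u : ℝ × ℝ := (φ, R φ)
  have hpol : ∃ L : ℝ × ℝ →L[ℝ] ℝ × ℝ,
      HasStrictFDerivAt (fun q : ℝ × ℝ => polar a b q.2 q.1) L u := by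
    have : ContDiff ℝ 1 (fun q : ℝ × ℝ => polar a b q.2 q.1) := by unfold polar; fun_prop
    exact ⟨_, this.contDiffAt.hasStrictFDerivAt one_ne_zero⟩
  obtain ⟨L, hL⟩ := hpol
  have hF : HasStrictFDerivAt (fun q : ℝ × ℝ => hamiltonian α β (polar a b q.2 q.1)) _ u :=
    (hasStrictFDerivAt_hamiltonian α β (polar a b (R φ) φ)).comp u hL
  set L' := (cuspPoly α (polar a b (R φ) φ).2 • ContinuousLinearMap.snd ℝ ℝ ℝ +
        cuspPoly β (polar a b (R φ) φ).1 • ContinuousLinearMap.fst ℝ ℝ ℝ).comp L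
  have hinv : (L' ∘L .inr ℝ ℝ ℝ).IsInvertible := by
    have h1 : HasDerivAt (fun r => hamiltonian α β (polar a b r φ)) (L' (0, 1)) (R φ) := by
      have := hF.hasFDerivAt.comp_hasDerivAt (R φ)
        ((hasDerivAt_const (R φ) φ).prodMk (hasDerivAt_id (R φ)))
      exact this
    have h2 := h1.unique (hasDerivAt_hamiltonian_polar α β a b φ (hR φ).ne')
    have h3 : L' (0, 1) ≠ 0 := by
      rw [h2]; exact (div_pos (virial_pos hh (hRh φ)) (hR φ)).ne'
    refine ⟨ContinuousLinearEquiv.unitsEquivAut ℝ (Units.mk0 _ h3), ?_⟩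
    ext
    simp
  have hψ := hF.hasStrictFDerivAt_implicitFunctionOfProdDomain hinv
  have hψt := hF.tendsto_implicitFunctionOfProdDomain hinv
  have hψe := hF.eventually_apply_implicitFunctionOfProdDomain hinv
  refine (hψ.hasFDerivAt.differentiableAt.congr_of_eventuallyEq ?_)
  filter_upwards [hψe, hψt.eventually (lt_mem_nhds (hR φ))] with θ h1 h2
  exact (huniq θ _ h2 (h1.trans (hRh φ))).symm

/-! ### The periodic orbit and its period -/

/-- A positive periodic density `w` defines the time `t = ∫ w dφ` as a function of the angle;
`θ` is the inverse function, which expresses the angle through the time. -/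
lemma exists_angle_of_density {w : ℝ → ℝ} (hw : Continuous w) (hpos : ∀ φ, 0 < w φ)
    (hper : Function.Periodic w (2 * Real.pi)) :
    ∃ θ : ℝ → ℝ, (∀ t, HasDerivAt θ (w (θ t))⁻¹ t) ∧ Function.Surjective θ ∧ StrictMono θ ∧
      ∀ t, θ (t + ∫ φ in (0 : ℝ)..2 * Real.pi, w φ) = θ t + 2 * Real.pi := by
  set τ : ℝ → ℝ := fun φ => ∫ s in (0 : ℝ)..φ, w s
  have hd : ∀ φ, HasDerivAt τ (w φ) φ := fun φ => (hw.integral_hasStrictDerivAt 0 φ).hasDerivAt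
  have hmono : StrictMono τ := strictMono_of_deriv_pos fun φ => by
    rw [(hd φ).deriv]; exact hpos φ
  have hint : ∀ s t, IntervalIntegrable w MeasureTheory.volume s t :=
    fun s t => hw.intervalIntegrable s t
  have hsurj : Function.Surjective τ :=
    (continuous_iff_continuousAt.2 fun φ => (hd φ).continuousAt).surjective
      (hper.tendsto_atTop_intervalIntegral_of_pos' (hint _ _) hpos Real.two_pi_pos)
      (hper.tendsto_atBot_intervalIntegral_of_pos' (hint _ _) hpos Real.two_pi_pos)
  set e := hmono.orderIsoOfSurjective τ hsurj
  have heτ : ∀ t, τ (e.symm t) = t := fun t => e.apply_symm_apply t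
  refine ⟨e.symm, fun t => ?_, e.symm.surjective, e.symm.strictMono, fun t => ?_⟩
  · exact HasDerivAt.of_local_left_inverse e.symm.continuous.continuousAt (hd _) (hpos _).ne'
      (Eventually.of_forall heτ)
  · apply hmono.injective
    rw [heτ]
    have h1 : τ (e.symm t + 2 * Real.pi) = τ (e.symm t) +
        ∫ s in e.symm t..e.symm t + 2 * Real.pi, w s :=
      (intervalIntegral.integral_add_adjacent_intervals (hint _ _) (hint _ _)).symm
    rw [h1, heτ, hper.intervalIntegral_add_eq (e.symm t) 0, zero_add]

/-- A differentiable polar parametrization of a level curve moves along the vector field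
`(f(y), -g(x))`; the factor is the time density `r² / (a b (f(y) y + g(x) x))`. -/
lemma hasDerivAt_polar_of_hamiltonian_eq {α β : Fin k → ℝ} {h : ℝ}
    (hh : h ∈ regularEnergies α β) {a b : ℝ} (ha : a ≠ 0) (hb : b ≠ 0) {R : ℝ → ℝ}
    (hR : Differentiable ℝ R) (hRh : ∀ φ, hamiltonian α β (polar a b (R φ) φ) = h) (φ : ℝ) :
    HasDerivAt (fun ψ => polar a b (R ψ) ψ)
      ((R φ ^ 2 / (a * b * virial α β (polar a b (R φ) φ))) •
        (cuspPoly α (polar a b (R φ) φ).2, -cuspPoly β (polar a b (R φ) φ).1)) φ := by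
  have hx : HasDerivAt (fun ψ => R ψ * (Real.sin ψ / b))
      (deriv R φ * (Real.sin φ / b) + R φ * (Real.cos φ / b)) φ :=
    (hR φ).hasDerivAt.mul ((Real.hasDerivAt_sin φ).div_const b)
  have hy : HasDerivAt (fun ψ => R ψ * (Real.cos ψ / a))
      (deriv R φ * (Real.cos φ / a) + R φ * (-Real.sin φ / a)) φ :=
    (hR φ).hasDerivAt.mul ((Real.hasDerivAt_cos φ).div_const a)
  refine (hx.prodMk hy).congr_deriv ?_
  have hH := hasDerivAt_hamiltonian_comp α β hx hy
  have hc : HasDerivAt (fun ψ => hamiltonian α β (R ψ * (Real.sin ψ / b), R ψ * (Real.cos ψ / a)))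
      0 φ := (hasDerivAt_const φ h).congr_of_eventuallyEq (Eventually.of_forall hRh)
  have h0 := hH.unique hc
  have hD := virial_pos hh (hRh φ)
  have hab : a * b * virial α β (polar a b (R φ) φ) ≠ 0 := by
    have := hD.ne'
    positivity
  -- Twice the rate at which area is swept out is `r² / (a b)`.
  have hcross : (deriv R φ * (Real.sin φ / b) + R φ * (Real.cos φ / b)) * (R φ * (Real.cos φ / a)) -
      (deriv R φ * (Real.cos φ / a) + R φ * (-Real.sin φ / a)) * (R φ * (Real.sin φ / b)) =
      R φ ^ 2 / (a * b) := by
    field_simp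
    linear_combination R φ ^ 2 * Real.sin_sq_add_cos_sq φ
  have hcross' := (eq_div_iff (mul_ne_zero ha hb)).1 hcross
  simp only [virial, polar] at hab ⊢
  generalize R φ * (Real.sin φ / b) = x at *
  generalize R φ * (Real.cos φ / a) = y at *
  generalize deriv R φ * (Real.sin φ / b) + R φ * (Real.cos φ / b) = x' at *
  generalize deriv R φ * (Real.cos φ / a) + R φ * (-Real.sin φ / a) = y' at *
  simp only [Prod.smul_mk, smul_eq_mul, Prod.mk.injEq]
  refine ⟨?_, ?_⟩
  · rw [div_mul_eq_mul_div, eq_div_iff hab, ← hcross']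
    linear_combination x * a * b * h0
  · rw [div_mul_eq_mul_div, eq_div_iff hab, ← hcross']
    linear_combination y * a * b * h0

/-- A regular level curve is a periodic orbit. The angular speed in elliptic polar coordinates is
`a b (f(y) y + g(x) x) / (b² x² + a² y²)`, and bounds on it bound the period. -/
lemma exists_isPeriodicOrbitWithMinimalPeriod (hk : 1 ≤ k) {α β : Fin k → ℝ} {h : ℝ}
    (hh : h ∈ regularEnergies α β) {a b : ℝ} (ha : 0 < a) (hb : 0 < b) :
    ∃ T, IsPeriodicOrbitWithMinimalPeriod α β (levelCurve α β h) T ∧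
      (∀ m > 0, (∀ p ∈ levelCurve α β h, m * sqRadius a b p ≤ virial α β p) →
        T ≤ 2 * Real.pi / (a * b * m)) ∧
      (∀ M > 0, (∀ p ∈ levelCurve α β h, virial α β p ≤ M * sqRadius a b p) →
        2 * Real.pi / (a * b * M) ≤ T) := by
  obtain ⟨R, hR0, hRh, huniq, hR⟩ := exists_radius hk hh ha.ne' hb.ne'
  set q : ℝ → ℝ × ℝ := fun φ => polar a b (R φ) φ with hq
  have hD : ∀ φ, 0 < virial α β (q φ) := fun φ => virial_pos hh (hRh φ)
  have hqd := hasDerivAt_polar_of_hamiltonian_eq hh ha.ne' hb.ne' hR hRh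
  have hqc : Continuous q := continuous_iff_continuousAt.2 fun φ => (hqd φ).continuousAt
  have hRper : Function.Periodic R (2 * Real.pi) := fun φ =>
    huniq φ _ (hR0 _) (by rw [← polar_add_two_pi, hRh])
  have hqper : Function.Periodic q (2 * Real.pi) := fun φ => by
    simp only [hq, polar_add_two_pi, hRper φ]
  have hrad : ∀ φ, sqRadius a b (q φ) = R φ ^ 2 := fun φ => sqRadius_polar ha.ne' hb.ne' _ _
  set w : ℝ → ℝ := fun φ => R φ ^ 2 / (a * b * virial α β (q φ)) with hw
  have hden : ∀ φ, 0 < a * b * virial α β (q φ) := fun φ => mul_pos (mul_pos ha hb) (hD φ)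
  have hwpos : ∀ φ, 0 < w φ := fun φ => div_pos (pow_pos (hR0 φ) 2) (hden φ)
  have hwc : Continuous w := (hR.continuous.pow 2).div
    (continuous_const.mul ((continuous_virial α β).comp hqc)) fun φ => (hden φ).ne'
  have hwper : Function.Periodic w (2 * Real.pi) := fun φ => by
    simp only [hw, hRper φ, hqper φ]
  obtain ⟨θ, hθd, hθs, hθm, hθT⟩ := exists_angle_of_density hwc hwpos hwper
  set T := ∫ φ in (0 : ℝ)..2 * Real.pi, w φ
  have hTpos : 0 < T :=
    intervalIntegral.intervalIntegral_pos_of_pos (hwc.intervalIntegrable _ _) hwpos Real.two_pi_pos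
  refine ⟨T, ⟨q ∘ θ, fun t => ?_, ?_, ⟨hTpos, fun t => ?_⟩, ?_⟩, fun m hm hle => ?_,
    fun M hM hle => ?_⟩
  · refine ((hqd (θ t)).scomp t (hθd t)).congr_deriv ?_
    change (w (θ t))⁻¹ • w (θ t) • _ = _
    rw [smul_smul, inv_mul_cancel₀ (hwpos (θ t)).ne', one_smul]
    rfl
  · rw [hθs.range_comp]
    ext p
    refine ⟨?_, fun hp => ?_⟩
    · rintro ⟨φ, rfl⟩
      exact hRh φ
    · have hp0 : p ≠ 0 := by
        rintro rfl
        exact hh.1.ne ((hamiltonian_zero α β).symm.trans hp)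
      obtain ⟨r, hr, φ, rfl⟩ := exists_eq_polar ha.ne' hb.ne' hp0
      exact ⟨φ, by rw [huniq φ r hr hp]⟩
  · simp only [Function.comp_apply, hθT, hqper (θ t)]
  · rintro σ ⟨hσ, hper⟩
    have h0 : q (θ σ) = q (θ 0) := by simpa using hper 0
    obtain ⟨n, hn⟩ := exists_int_of_polar_eq_polar ha.ne' hb.ne' (hR0 _) (hR0 _) h0
    have hlt : θ 0 < θ σ := hθm hσ
    have hn1 : 1 ≤ n := by
      by_contra! hn0
      have : (n : ℝ) ≤ 0 := by exact_mod_cast Int.lt_add_one_iff.1 hn0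
      nlinarith [Real.two_pi_pos]
    have hn1' : (1 : ℝ) ≤ n := by exact_mod_cast hn1
    rw [← hθm.le_iff_le, ← zero_add T, hθT, hn]
    nlinarith [Real.two_pi_pos]
  · have : T ≤ ∫ _φ in (0 : ℝ)..2 * Real.pi, 1 / (a * b * m) :=
      intervalIntegral.integral_mono Real.two_pi_pos.le (hwc.intervalIntegrable _ _)
        intervalIntegrable_const fun φ => by
          have := hle (q φ) (hRh φ)
          rw [hrad] at this
          simp only [hw]
          rw [div_le_div_iff₀ (hden φ) (by positivity)]
          nlinarith [mul_pos ha hb]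
    rwa [intervalIntegral.integral_const, smul_eq_mul, mul_one_div, sub_zero] at this
  · have : ∫ _φ in (0 : ℝ)..2 * Real.pi, 1 / (a * b * M) ≤ T :=
      intervalIntegral.integral_mono Real.two_pi_pos.le intervalIntegrable_const
        (hwc.intervalIntegrable _ _) fun φ => by
          have := hle (q φ) (hRh φ)
          rw [hrad] at this
          simp only [hw]
          rw [div_le_div_iff₀ (by positivity) (hden φ)]
          nlinarith [mul_pos ha hb]
    rwa [intervalIntegral.integral_const, smul_eq_mul, mul_one_div, sub_zero] at this

/-! ### Uniqueness of the minimal period -/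

/-- Two solutions with the same orbit differ by a translation in time, by uniqueness for
differential equations with a locally Lipschitz vector field; hence their periods agree. -/
lemma IsPeriodicOrbitWithMinimalPeriod.unique {α β : Fin k → ℝ} {Γ : Set (ℝ × ℝ)} {S T : ℝ}
    (hS : IsPeriodicOrbitWithMinimalPeriod α β Γ S)
    (hT : IsPeriodicOrbitWithMinimalPeriod α β Γ T) : S = T := by
  obtain ⟨γ, hγ, hγΓ, hγS⟩ := hS
  obtain ⟨δ, hδ, hδΓ, hδT⟩ := hT
  have hcomp : IsCompact Γ := by
    rw [← hγΓ]
    exact hγS.1.2.compact_of_continuous hγS.1.1.ne'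
      (continuous_iff_continuousAt.2 fun t => (hγ t).continuousAt)
  have hv : ContDiff ℝ 1 fun p : ℝ × ℝ => (cuspPoly α p.2, -cuspPoly β p.1) :=
    ((contDiff_cuspPoly α).comp contDiff_snd).prodMk ((contDiff_cuspPoly β).comp contDiff_fst).neg
  obtain ⟨K, hK⟩ := hv.locallyLipschitz.locallyLipschitzOn.exists_lipschitzOnWith_of_compact hcomp
  obtain ⟨s, hs⟩ : δ 0 ∈ Set.range γ := by rw [hγΓ, ← hδΓ]; exact ⟨0, rfl⟩
  have heq : δ = fun t => γ (t + s) :=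
    ODE_solution_unique_univ (v := fun _ p => (cuspPoly α p.2, -cuspPoly β p.1))
      (s := fun _ => Γ) (K := K) (t₀ := 0) (fun _ => hK)
      (fun t => ⟨hδ t, hδΓ ▸ ⟨t, rfl⟩⟩)
      (fun t => ⟨(hγ (t + s)).comp_add_const t s, hγΓ ▸ ⟨t + s, rfl⟩⟩) (by simp [hs])
  have hper : ∀ τ, Function.Periodic δ τ ↔ Function.Periodic γ τ := fun τ => by
    subst heq
    refine ⟨fun h t => ?_, fun h t => ?_⟩
    · have := h (t - s)
      simpa [add_right_comm] using this
    · simpa [add_right_comm] using h (t + s)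
  simp only [hper] at hδT
  exact hγS.unique hδT

lemma IsPeriodicOrbitWithMinimalPeriod.periodFunction_eq {α β : Fin k → ℝ} {h T : ℝ}
    (hT : IsPeriodicOrbitWithMinimalPeriod α β (levelCurve α β h) T) :
    periodFunction α β h = T := by
  have : {S | IsPeriodicOrbitWithMinimalPeriod α β (levelCurve α β h) S} = {T} :=
    Set.eq_singleton_iff_unique_mem.2
      ⟨hT, fun _ hS => IsPeriodicOrbitWithMinimalPeriod.unique hS hT⟩
  rw [periodFunction, this, csInf_singleton]

/-! ### Location of the level curves for small and large energies -/

lemma eventually_nhdsGT_zero_mem_regularEnergies (α β : Fin k → ℝ) :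
    ∀ᶠ h in 𝓝[>] (0 : ℝ), h ∈ regularEnergies α β := by
  have hpos : ∀ᶠ h in 𝓝[>] (0 : ℝ), 0 < h := self_mem_nhdsWithin
  refine hpos.and (eventually_all.2 fun ij => ?_)
  rcases le_or_gt (criticalValue α β ij) 0 with hc | hc
  · filter_upwards [self_mem_nhdsWithin] with h (hh : 0 < h)
    exact (hc.trans_lt hh).ne'
  · filter_upwards [mem_nhdsWithin_of_mem_nhds (Iio_mem_nhds hc)] with h hh
    exact ne_of_lt hh

lemma eventually_atTop_mem_regularEnergies (α β : Fin k → ℝ) :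
    ∀ᶠ h in atTop, h ∈ regularEnergies α β :=
  (eventually_gt_atTop 0).and (eventually_all.2 fun _ => eventually_ne_atTop _)

lemma exists_of_eventually_nhds_zero {a b : ℝ} (ha : 0 < a) (hb : 0 < b) {P : ℝ × ℝ → Prop}
    (hP : ∀ᶠ p in 𝓝 0, P p) : ∃ δ > 0, ∀ p, sqRadius a b p < δ ^ 2 → P p := by
  obtain ⟨ε, hε, hP⟩ := Metric.eventually_nhds_iff.1 hP
  refine ⟨ε * min a b, mul_pos hε (lt_min ha hb), fun p hp => hP ?_⟩
  have hm : 0 < min a b := lt_min ha hb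
  unfold sqRadius at hp
  rw [dist_zero_right, Prod.norm_def, max_lt_iff, Real.norm_eq_abs, Real.norm_eq_abs]
  constructor
  · have h1 : (b * p.1) ^ 2 < (ε * min a b) ^ 2 := by nlinarith [sq_nonneg (a * p.2)]
    have h2 := abs_lt_of_sq_lt_sq h1 (by positivity)
    rw [abs_mul, abs_of_pos hb] at h2
    nlinarith [min_le_right a b]
  · have h1 : (a * p.2) ^ 2 < (ε * min a b) ^ 2 := by nlinarith [sq_nonneg (b * p.1)]
    have h2 := abs_lt_of_sq_lt_sq h1 (by positivity)
    rw [abs_mul, abs_of_pos ha] at h2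
    nlinarith [min_le_left a b]

/-- The level curves shrink to the origin as the energy tends to `0`. -/
lemma eventually_forall_mem_levelCurve {α β : Fin k → ℝ} (hα : ∀ i, α i ≠ 0)
    (hβ : ∀ i, β i ≠ 0) {P : ℝ × ℝ → Prop} (hP : ∀ᶠ p in 𝓝 0, P p) :
    ∀ᶠ h in 𝓝[>] (0 : ℝ), ∀ p ∈ levelCurve α β h, P p := by
  set a := ∏ i, |α i|
  set b := ∏ i, |β i|
  have ha : 0 < a := Finset.prod_pos fun i _ => abs_pos.2 (hα i)
  have hb : 0 < b := Finset.prod_pos fun i _ => abs_pos.2 (hβ i)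
  obtain ⟨δ, hδ, hδP⟩ := exists_of_eventually_nhds_zero ha hb
    (hP.and (eventually_abs_virial_sub_sqRadius_le hα hβ (half_pos one_pos)))
  -- The radial derivative of `H` is at least `r / 2` for `r < δ`, so that `H ≥ δ² / 16`
  -- from the radius `δ / 2` on.
  have hmono : ∀ φ, MonotoneOn (fun r => hamiltonian α β (polar a b r φ) - r ^ 2 / 4)
      (Set.Icc 0 (δ / 2)) := fun φ => by
    have hder : ∀ r, 0 < r → HasDerivAt (fun r => hamiltonian α β (polar a b r φ) - r ^ 2 / 4)
        (virial α β (polar a b r φ) / r - r / 2) r := fun r hr => by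
      refine ((hasDerivAt_hamiltonian_polar α β a b φ hr.ne').sub
        (((hasDerivAt_id r).pow 2).div_const 4)).congr_deriv ?_
      simp; ring
    refine monotoneOn_of_deriv_nonneg (convex_Icc _ _)
      (((continuous_hamiltonian α β).comp (continuous_polar_radius a b φ)).sub
        (by fun_prop)).continuousOn ?_ ?_ <;> rw [interior_Icc] <;> rintro r ⟨hr, hr'⟩
    · exact (hder r hr).differentiableAt.differentiableWithinAt
    · rw [(hder r hr).deriv, sub_nonneg, le_div_iff₀ hr]
      have := (hδP (polar a b r φ) (by
        rw [sqRadius_polar ha.ne' hb.ne']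
        exact pow_lt_pow_left₀ (by linarith) hr.le two_ne_zero)).2
      rw [sqRadius_polar ha.ne' hb.ne', abs_le] at this
      nlinarith
  filter_upwards [self_mem_nhdsWithin, mem_nhdsWithin_of_mem_nhds
    (Iio_mem_nhds (show (0 : ℝ) < δ ^ 2 / 16 by positivity))] with h (hh : 0 < h) hh' p hp
  have hp0 : p ≠ 0 := by
    rintro rfl
    exact hh.ne ((hamiltonian_zero α β).symm.trans hp)
  obtain ⟨r, hr, φ, rfl⟩ := exists_eq_polar ha.ne' hb.ne' hp0
  refine (hδP _ ?_).1
  rw [sqRadius_polar ha.ne' hb.ne']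
  by_contra! hle
  have hrδ : δ ≤ r := (pow_le_pow_iff_left₀ hδ.le hr.le two_ne_zero).1 hle
  have h1 := monotoneOn_hamiltonian_polar α β a b φ (half_pos hδ).le hr.le (by linarith : δ / 2 ≤ r)
  have h2 := hmono φ ⟨le_rfl, (half_pos hδ).le⟩ ⟨(half_pos hδ).le, le_rfl⟩ (half_pos hδ).le
  have h0 : hamiltonian α β (polar a b 0 φ) = 0 := by
    simp [polar, ← Prod.zero_eq_mk, hamiltonian_zero]
  simp only [h0] at h1 h2
  have h3 : hamiltonian α β (polar a b r φ) = h := hp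
  have h4 : h < δ ^ 2 / 16 := hh'
  nlinarith

/-- The level curves recede to infinity as the energy tends to `∞`. -/
lemma eventually_forall_mem_levelCurve_le_norm (α β : Fin k → ℝ) (S : ℝ) :
    ∀ᶠ h in atTop, ∀ p ∈ levelCurve α β h, S ≤ ‖p‖ := by
  obtain ⟨C, hC⟩ := (isCompact_closedBall (0 : ℝ × ℝ) S).bddAbove_image
    (continuous_hamiltonian α β).continuousOn
  filter_upwards [eventually_gt_atTop C] with h hh p hp
  by_contra! hlt
  have h1 := hC ⟨p, mem_closedBall_zero_iff.2 hlt.le, rfl⟩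
  have h2 : hamiltonian α β p = h := hp
  linarith

/-! ### The limits of the period function -/

lemma tendsto_periodFunction_nhdsGT_zero (hk : 1 ≤ k) {α β : Fin k → ℝ} (hα : ∀ i, α i ≠ 0)
    (hβ : ∀ i, β i ≠ 0) :
    Tendsto (periodFunction α β) (𝓝[>] 0) (𝓝 (2 * Real.pi / ∏ i, |α i * β i|)) := by
  set a := ∏ i, |α i|
  set b := ∏ i, |β i|
  have ha : 0 < a := Finset.prod_pos fun i _ => abs_pos.2 (hα i)
  have hb : 0 < b := Finset.prod_pos fun i _ => abs_pos.2 (hβ i)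
  have hab : ∏ i, |α i * β i| = a * b := by simp only [abs_mul, Finset.prod_mul_distrib, a, b]
  have hbound : ∀ ε : ℝ, 0 < ε → ε < 1 → ∀ᶠ h in 𝓝[>] (0 : ℝ),
      2 * Real.pi / (a * b * (1 + ε)) ≤ periodFunction α β h ∧
        periodFunction α β h ≤ 2 * Real.pi / (a * b * (1 - ε)) := fun ε hε hε1 => by
    filter_upwards [eventually_nhdsGT_zero_mem_regularEnergies α β,
      eventually_forall_mem_levelCurve hα hβ (eventually_abs_virial_sub_sqRadius_le hα hβ hε)]
      with h hh hv
    obtain ⟨T, hT, hle, hge⟩ := exists_isPeriodicOrbitWithMinimalPeriod hk hh ha hb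
    rw [hT.periodFunction_eq]
    refine ⟨hge _ (by linarith) fun p hp => ?_, hle _ (by linarith) fun p hp => ?_⟩ <;>
    · have := abs_le.1 (hv p hp)
      linarith
  have hlim : ∀ c : ℝ, Tendsto (fun ε : ℝ => 2 * Real.pi / (a * b * (1 + c * ε))) (𝓝[>] 0)
      (𝓝 (2 * Real.pi / (a * b))) := fun c => by
    have : ContinuousAt (fun ε : ℝ => 2 * Real.pi / (a * b * (1 + c * ε))) 0 :=
      continuousAt_const.div (by fun_prop) (by simp [ha.ne', hb.ne'])
    simpa using this.tendsto.mono_left nhdsWithin_le_nhds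
  have hsmall : ∀ᶠ ε in 𝓝[>] (0 : ℝ), 0 < ε ∧ ε < 1 := Ioo_mem_nhdsGT one_pos
  rw [hab]
  refine tendsto_order.2 ⟨fun c hc => ?_, fun c hc => ?_⟩
  · obtain ⟨ε, h1, hε, hε1⟩ := (((hlim 1).eventually (lt_mem_nhds hc)).and hsmall).exists
    rw [one_mul] at h1
    filter_upwards [hbound ε hε hε1] with h hh using h1.trans_le hh.1
  · obtain ⟨ε, h1, hε, hε1⟩ := (((hlim (-1)).eventually (gt_mem_nhds hc)).and hsmall).exists
    rw [neg_one_mul, ← sub_eq_add_neg] at h1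
    filter_upwards [hbound ε hε hε1] with h hh using hh.2.trans_lt h1

lemma tendsto_periodFunction_atTop (hk : 1 ≤ k) (α β : Fin k → ℝ) :
    Tendsto (periodFunction α β) atTop (𝓝 0) := by
  refine tendsto_order.2 ⟨fun c hc => ?_, fun c hc => ?_⟩
  · filter_upwards [eventually_atTop_mem_regularEnergies α β] with h hh
    obtain ⟨T, hT, -⟩ := exists_isPeriodicOrbitWithMinimalPeriod hk hh one_pos one_pos
    rw [hT.periodFunction_eq]
    obtain ⟨γ, -, -, hT⟩ := hT
    exact hc.trans hT.1.1
  · -- An angular speed of at least `4π / c` makes the period at most `c / 2`.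
    set m := 4 * Real.pi / c with hm
    have hm0 : 0 < m := by have := Real.pi_pos; positivity
    obtain ⟨S, -, hS⟩ := exists_mul_le_virial hk α β (mul_pos two_pos hm0).le
    filter_upwards [eventually_atTop_mem_regularEnergies α β,
      eventually_forall_mem_levelCurve_le_norm α β S] with h hh hn
    obtain ⟨T, hT, hle, -⟩ := exists_isPeriodicOrbitWithMinimalPeriod hk hh one_pos one_pos
    rw [hT.periodFunction_eq]
    have hT' := hle m hm0 fun p hp => by
      have h1 := sqRadius_le 1 1 p
      have h2 := hS p (hn p hp)
      nlinarith
    refine hT'.trans_lt ?_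
    rw [hm, div_lt_iff₀ (by have := Real.pi_pos; positivity)]
    field_simp
    norm_num

lemma ne_zero_of_injective_criticalValue {α β : Fin k → ℝ}
    (hH : Function.Injective (criticalValue α β)) : (∀ i, α i ≠ 0) ∧ ∀ i, β i ≠ 0 := by
  refine ⟨fun i hi => ?_, fun i hi => ?_⟩
  · have : criticalValue α β (0, i.succ) = criticalValue α β (0, 0) := by
      simp [criticalValue, extend, hi]
    simpa using hH this
  · have : criticalValue α β (i.succ, 0) = criticalValue α β (0, 0) := by
      simp [criticalValue, extend, hi]
    simpa using hH this

end PeriodSystem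

theorem mainTheorem3 (k : ℕ) (hk : 1 ≤ k) (α β : Fin k → ℝ)
    (hH : Function.Injective (PeriodSystem.criticalValue α β)) :
    (∀ h ∈ PeriodSystem.regularEnergies α β,
      PeriodSystem.IsPeriodicOrbitWithMinimalPeriod α β (PeriodSystem.levelCurve α β h)
        (PeriodSystem.periodFunction α β h) ∧
      ∀ T : ℝ, PeriodSystem.IsPeriodicOrbitWithMinimalPeriod α β
        (PeriodSystem.levelCurve α β h) T → T = PeriodSystem.periodFunction α β h) ∧
    Tendsto (PeriodSystem.periodFunction α β) (𝓝[>] 0)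
      (𝓝 (2 * Real.pi / ∏ i, |α i * β i|)) ∧
    Tendsto (PeriodSystem.periodFunction α β) atTop (𝓝 0) := by
  obtain ⟨hα, hβ⟩ := PeriodSystem.ne_zero_of_injective_criticalValue hH
  refine ⟨fun h hh => ?_, PeriodSystem.tendsto_periodFunction_nhdsGT_zero hk hα hβ,
    PeriodSystem.tendsto_periodFunction_atTop hk α β⟩
  obtain ⟨T, hT, -⟩ :=
    PeriodSystem.exists_isPeriodicOrbitWithMinimalPeriod hk hh one_pos one_pos
  rw [hT.periodFunction_eq]
  exact ⟨hT, fun S hS => hS.unique hT⟩
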